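/- Theorem 2. There exist a countable set $X$ (with the discrete $\sigma$-algebra), a Markov transition kernel $P$ on $X$ and a probability measure $\pi$ on $X$ that is invariant for $P$ such that the following hold. (a) The chain is $\psi$-irreducible and aperiodic: there is a nonzero $\sigma$-finite measure $\psi$ on $X$ such that for every $A\subseteq X$ with $\psi(A)>0$ and every $x\in X$ one has $P^n(x,A)>0$ for all sufficiently large $n$, and $\psi$ is maximal, in the sense that every other $\sigma$-finite measure with this property is absolutely continuous with respect to $\psi$. (b) The chain is geometrically ergodic: there are functions $\rho:X\to(0,1)$ and $C:X\to[1,\infty)$ such that, for $\pi$-almost every $x$, $$\sup_{A\subseteq X}|P^n(x,A)-\pi(A)|\le C(x)\,\rho(x)^n\qquad\text{for all } n\ge 0 .$$ (c) $P$ does not admit a spectral gap in $L_2(\pi)$. That is, let $P$ act on the complex Hilbert space $L_2(\pi)$ by $PF(x)=\int F(y)\,P(x,dy)$, and let $\mathcal S_2$ be the set of nonzero $\lambda\in\mathbb C$ for which $\lambda I-P$ has no bounded inverse on $L_2(\pi)$. Then there is no $\varepsilon_0>0$ such that $\mathcal S_2\cap\{z:|z|\ge 1-\varepsilon_0\}$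 is finite and consists only of poles of finite multiplicity, that is, of isolated points of the spectrum whose spectral projection $\frac1{2\pi i}\oint (zI-P)^{-1}dz$ (over a small circle around the point) has finite rank. (d) There is a function $G:X\to\mathbb R$ in $L_2(\pi)$ with $\int G\,d\pi=0$ such that, for the stationary chain $(X(i))_{i\ge0}$ with transition kernel $P$ and $X(0)\sim\pi$, the distributions of the normalized sums $$\frac1{\sqrt n}\sum_{i=0}^{n-1}G(X(i)),\qquad n\ge 1,$$ do not form a tight family of probability measures on $\mathbb R$. -/

import Mathlib

open MeasureTheory ProbabilityTheory
open scoped ENNReal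

noncomputable section

namespace MarkovGap

section Kernel

variable {X : Type*} [MeasurableSpace X]

/-- `ψ` is a `σ`-finite measure such that every measurable set of positive `ψ`-measure has, from
every initial state, positive probability under `P ^ n` for all sufficiently large `n`. -/
def IsAperiodicIrreducibilityMeasure (P : Kernel X X) (ψ : Measure X) : Prop :=
  SigmaFinite ψ ∧ ∀ A : Set X, MeasurableSet A → 0 < ψ A →
    ∀ x : X, ∃ N : ℕ, ∀ n : ℕ, N ≤ n → 0 < (P ^ n) x A

/-- The chain with transition kernel `P` is `ψ`-irreducible and aperiodic: there is a nontrivial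
measure `ψ` as above which is maximal, that is, any other one is absolutely continuous with
respect to `ψ`. -/
def IsPsiIrreducibleAperiodic (P : Kernel X X) : Prop :=
  ∃ ψ : Measure X, ψ ≠ 0 ∧ IsAperiodicIrreducibilityMeasure P ψ ∧
    ∀ ψ' : Measure X, IsAperiodicIrreducibilityMeasure P ψ' → ψ' ≪ ψ

/-- Total variation distance `sup_A |μ A - ν A|` of two finite measures. -/
def tvDist (μ ν : Measure X) : ℝ≥0∞ :=
  ⨆ (A : Set X) (_ : MeasurableSet A), ENNReal.ofReal |μ.real A - ν.real A|

/-- The chain with transition kernel `P` is geometrically ergodic, with invariant probability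
measure `π`: for functions `ρ : X → (0, 1)` and `C : X → [1, ∞)`, one has
`‖P ^ n (x, ·) - π‖_TV ≤ C x * ρ x ^ n` for all `n ≥ 0`, for `π`-almost every `x`. -/
def IsGeometricallyErgodic (P : Kernel X X) (π : Measure X) : Prop :=
  IsProbabilityMeasure π ∧ P.Invariant π ∧
    ∃ ρ C : X → ℝ, (∀ x, 0 < ρ x ∧ ρ x < 1) ∧ (∀ x, 1 ≤ C x) ∧
      ∀ᵐ x ∂π, ∀ n : ℕ, tvDist ((P ^ n) x) π ≤ ENNReal.ofReal (C x * ρ x ^ n)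

/-- The law on the path space of the stationary Markov chain `(X 0, X 1, …)` with transition
kernel `P` and initial distribution `π`. -/
def pathLaw (P : Kernel X X) [IsMarkovKernel P] (π : Measure X) : Measure (ℕ → X) :=
  Kernel.trajMeasure (X := fun _ => X) π fun n =>
    P.comap (fun w : (i : Finset.Iic n) → X => w ⟨n, Finset.mem_Iic.2 le_rfl⟩)
      (measurable_pi_apply _)

/-- The normalized partial sum `n ^ (-1/2) * ∑_{i < n} G (X i)`. -/
def normalizedSum (G : X → ℝ) (n : ℕ) (w : ℕ → X) : ℝ :=
  (∑ i ∈ Finset.range n, G (w i)) / Real.sqrt n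

end Kernel

section L2

variable {X : Type*} [MeasurableSpace X] {P : Kernel X X} {π : Measure X}

theorem integral_kernel_congr_ae (hπ : P.Invariant π) {F G : X → ℂ} (h : F =ᵐ[π] G) :
    (fun x => ∫ y, F y ∂P x) =ᵐ[π] fun x => ∫ y, G y ∂P x := by
  have hb : π.bind P = π := hπ
  have h' : F =ᵐ[π.bind P] G := by rwa [hb]
  filter_upwards [Measure.ae_ae_of_ae_comp h'] with x hx
  exact integral_congr_ae hx

theorem ae_integrable_kernel [IsFiniteMeasure π] (hπ : P.Invariant π) (F : Lp ℂ 2 π) :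
    ∀ᵐ x ∂π, Integrable F (P x) := by
  have hb : π.bind P = π := hπ
  have h : Integrable F (π.bind P) := by
    rw [hb]; exact (Lp.memLp F).integrable (by norm_num)
  exact Measure.ae_integrable_of_integrable_comp h

variable [IsMarkovKernel P]

theorem eLpNorm_integral_kernel_le (hπ : P.Invariant π) {F : X → ℂ}
    (hF : AEStronglyMeasurable F π) :
    eLpNorm (fun x => ∫ y, F y ∂P x) 2 π ≤ eLpNorm F 2 π := by
  have hb : π.bind P = π := hπ
  have hF' : AEStronglyMeasurable F (π.bind P) := by rwa [hb]
  have h1 : ∀ᵐ x ∂π, AEStronglyMeasurable F (P x) := by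
    filter_upwards [Measure.ae_ae_of_ae_comp hF'.ae_eq_mk] with x hx
    exact ⟨hF'.mk F, hF'.stronglyMeasurable_mk, hx⟩
  have h2 : ∀ᵐ x ∂π, ‖∫ y, F y ∂P x‖ₑ ^ (2 : ℝ) ≤ ∫⁻ y, ‖F y‖ₑ ^ (2 : ℝ) ∂P x := by
    filter_upwards [h1] with x hx
    have h3 : ‖∫ y, F y ∂P x‖ₑ ≤ eLpNorm F 2 (P x) :=
      calc ‖∫ y, F y ∂P x‖ₑ ≤ ∫⁻ y, ‖F y‖ₑ ∂P x := enorm_integral_le_lintegral_enorm _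
        _ = eLpNorm F 1 (P x) := eLpNorm_one_eq_lintegral_enorm.symm
        _ ≤ eLpNorm F 2 (P x) := eLpNorm_le_eLpNorm_of_exponent_le (by norm_num) hx
    calc ‖∫ y, F y ∂P x‖ₑ ^ (2 : ℝ) ≤ (eLpNorm F 2 (P x)) ^ (2 : ℝ) := by gcongr
      _ = ∫⁻ y, ‖F y‖ₑ ^ (2 : ℝ) ∂P x := by
        rw [eLpNorm_eq_lintegral_rpow_enorm_toReal (by norm_num) (by norm_num)]
        rw [← ENNReal.rpow_mul]
        norm_num
  rw [eLpNorm_eq_lintegral_rpow_enorm_toReal (by norm_num) (by norm_num),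
    eLpNorm_eq_lintegral_rpow_enorm_toReal (by norm_num) (by norm_num)]
  simp only [ENNReal.toReal_ofNat]
  gcongr ?_ ^ _
  calc ∫⁻ x, ‖∫ y, F y ∂P x‖ₑ ^ (2 : ℝ) ∂π
      ≤ ∫⁻ x, ∫⁻ y, ‖F y‖ₑ ^ (2 : ℝ) ∂P x ∂π := lintegral_mono_ae h2
    _ = ∫⁻ y, ‖F y‖ₑ ^ (2 : ℝ) ∂(π.bind P) :=
        (Measure.lintegral_bind P.aemeasurable (hF'.enorm.pow_const _)).symm
    _ = ∫⁻ y, ‖F y‖ₑ ^ (2 : ℝ) ∂π := by rw [hb]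

theorem memLp_integral_kernel (hπ : P.Invariant π) {F : X → ℂ} (hF : MemLp F 2 π) :
    MemLp (fun x => ∫ y, F y ∂P x) 2 π := by
  have hb : π.bind P = π := hπ
  refine ⟨?_, (eLpNorm_integral_kernel_le hπ hF.1).trans_lt hF.2⟩
  have hF' : AEStronglyMeasurable F (π.bind P) := by rw [hb]; exact hF.1
  refine ⟨fun x => ∫ y, hF'.mk F y ∂P x, hF'.stronglyMeasurable_mk.integral_kernel, ?_⟩
  filter_upwards [Measure.ae_ae_of_ae_comp hF'.ae_eq_mk] with x hx
  exact integral_congr_ae hx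

/-- The transition kernel `P`, with invariant finite measure `π`, as a bounded linear operator
on the complex Hilbert space `L₂(π)`, acting by `(P F)(x) = ∫ F(y) P(x, dy)`. -/
def l2Operator (P : Kernel X X) [IsMarkovKernel P] (π : Measure X) [IsFiniteMeasure π]
    (hπ : P.Invariant π) : Lp ℂ 2 π →L[ℂ] Lp ℂ 2 π :=
  LinearMap.mkContinuous
    { toFun := fun F => (memLp_integral_kernel hπ (Lp.memLp F)).toLp
      map_add' := fun F G => by
        rw [← MemLp.toLp_add]
        refine MemLp.toLp_congr _ _ ?_
        filter_upwards [integral_kernel_congr_ae hπ (Lp.coeFn_add F G),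
          ae_integrable_kernel hπ F, ae_integrable_kernel hπ G] with x hx h1 h2
        rw [hx]
        exact integral_add h1 h2
      map_smul' := fun c F => by
        rw [RingHom.id_apply, ← MemLp.toLp_const_smul]
        refine MemLp.toLp_congr _ _ ?_
        filter_upwards [integral_kernel_congr_ae hπ (Lp.coeFn_smul c F)] with x hx
        rw [hx]
        exact integral_smul c _ }
    1 (fun F => by
      rw [one_mul]
      change ‖(memLp_integral_kernel hπ (Lp.memLp F)).toLp‖ ≤ ‖F‖
      rw [Lp.norm_toLp, Lp.norm_def]
      exact ENNReal.toReal_mono (Lp.eLpNorm_ne_top F)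
        (eLpNorm_integral_kernel_le hπ (Lp.aestronglyMeasurable F)))

theorem l2Operator_ae_eq [IsFiniteMeasure π] (hπ : P.Invariant π) (F : Lp ℂ 2 π) :
    l2Operator P π hπ F =ᵐ[π] fun x => ∫ y, F y ∂P x :=
  MemLp.coeFn_toLp (memLp_integral_kernel hπ (Lp.memLp F))

end L2

section Spectrum

variable {E : Type*} [NormedAddCommGroup E] [NormedSpace ℂ E]

/-- The set of nonzero `z` for which `(z I - T)⁻¹` does not exist as a bounded operator. -/
def nonzeroSpectrum (T : E →L[ℂ] E) : Set ℂ :=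
  {z | z ≠ 0 ∧ z ∈ spectrum ℂ T}

/-- `z₀` is a pole of finite multiplicity of `T`: it is an isolated point of the spectrum, and the
spectral projection `(2πi)⁻¹ ∮ (z I - T)⁻¹ dz` over a small circle around `z₀`, which encloses and
meets no other point of the spectrum, has finite rank. -/
def IsPoleOfFiniteMultiplicity (T : E →L[ℂ] E) (z₀ : ℂ) : Prop :=
  z₀ ∈ spectrum ℂ T ∧ ∃ r : ℝ, 0 < r ∧
    (∀ z ∈ spectrum ℂ T, z ∈ Metric.closedBall z₀ r → z = z₀) ∧
    FiniteDimensional ℂ (LinearMap.range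
      ((2 * (Real.pi : ℂ) * Complex.I)⁻¹ • ∮ z in C(z₀, r), resolvent T z).toLinearMap)

/-- `T` admits a spectral gap: for some `ε > 0`, the part of the nonzero spectrum in `|z| ≥ 1 - ε`
is finite and consists of poles of finite multiplicity. -/
def HasSpectralGap (T : E →L[ℂ] E) : Prop :=
  ∃ ε : ℝ, 0 < ε ∧ (nonzeroSpectrum T ∩ {z : ℂ | 1 - ε ≤ ‖z‖}).Finite ∧
    ∀ z ∈ nonzeroSpectrum T ∩ {z : ℂ | 1 - ε ≤ ‖z‖}, IsPoleOfFiniteMultiplicity T z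

end Spectrum

end MarkovGap

end

/-! The chain is a renewal process: independent blocks follow each other, of length `m + 1` with `m`
geometric of ratio `1 / 16` and with a fair random sign, and the state shows age, remaining time and
sign. Once a block is drawn, the motion is deterministic until it ends.

Ergodicity. From remaining time `k`, the chain is fresh after `k + 1` steps. The renewal equation
and the exponential moment bound `integrable_integral_mul_two_pow_le` make the laws from a fresh
start converge at rate `1 / 2` (`abs_fresh_succ_sub_le`). Waiting for the current block to end only
costs a factor `2 ^ (k + 1)`. This factor is unbounded in the state, which leaves room for the
failure of the gap.

Spectrum. For `‖z‖ = 1`, the function `z ^ j` on the positive blocks of length `m + 1` is an exact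
eigenfunction except at ends of blocks. Its squared norm is `m + 1` times that of an indicator of
one state, while its defect is comparable to a single such indicator. Letting `m` grow puts the
whole unit circle in the spectrum (`mem_spectrum_of_norm_eq_one`).

Tightness. Let the observable be `± 4 ^ m * lacunary m` on blocks of length `m + 1`. Such blocks
have frequency of order `16 ^ (-m)`, so square integrability only asks that `(m + 1) * lacunary m ^
2` be summable. Within time `N = 16 ^ m / 4` there is, with probability bounded below, exactly one
block of this length, and it contributes `2 * (m + 1) * lacunary m` to the normalized sum in
absolute value, which is unbounded along `m = 4 ^ i`. The other blocks cannot cancel it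
systematically: reversing the sign of the blocks of this one length preserves the law of the path,
so at least half of the probability survives (`pathLaw_real_abs_sum_ge`). -/

noncomputable section

namespace MarkovGap.Renewal

/-! ### The chain of blocks and its stationary law. -/

/-- The geometric law on `ℕ`, giving mass `(15 / 16) * (1 / 16) ^ n` to `n`. -/
def geom : Measure ℕ := geometricMeasure ⟨15 / 16, by norm_num, by norm_num⟩

/-- The law of a fair coin. -/
def coin : Measure Bool := (2⁻¹ : ℝ≥0∞) • (Measure.dirac true + Measure.dirac false)

/-- The law of the length and of the sign of a fresh block. -/
def blockLaw : Measure (ℕ × Bool) := geom.prod coin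

/-- A state `(j, k, s)` records the time `j` elapsed since the start of the current block, the time
`k` remaining until its end, and its sign `s`. -/
abbrev State : Type := ℕ × ℕ × Bool

/-- The transition probabilities: the chain moves deterministically inside a block, and a
fresh block is drawn from `blockLaw` when the current one is over. -/
def step : State → Measure State
  | (_, 0, _) => blockLaw.map (Prod.mk 0)
  | (j, k + 1, s) => Measure.dirac (j + 1, k, s)

/-- The transition kernel of the chain of blocks. -/
def chain : Kernel State State := Kernel.ofFunOfCountable step

/-- The stationary law of the chain of blocks. -/
def stationary : Measure State := geom.prod blockLaw

instance : IsProbabilityMeasure geom := by unfold geom; infer_instance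

instance : IsProbabilityMeasure coin :=
  ⟨by simp [coin, ENNReal.inv_two_add_inv_two]⟩

instance : IsProbabilityMeasure blockLaw := by unfold blockLaw; infer_instance

instance : IsProbabilityMeasure stationary := by unfold stationary; infer_instance

theorem chain_zero (j : ℕ) (s : Bool) : chain (j, 0, s) = blockLaw.map (Prod.mk 0) := rfl

theorem chain_succ (j k : ℕ) (s : Bool) : chain (j, k + 1, s) = Measure.dirac (j + 1, k, s) := rfl

instance : IsMarkovKernel chain := by
  refine ⟨?_⟩
  rintro ⟨j, k, s⟩
  cases k with
  | zero => rw [chain_zero]; exact Measure.isProbabilityMeasure_map (by fun_prop)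
  | succ k => rw [chain_succ]; infer_instance

theorem geom_real_singleton (n : ℕ) : geom.real {n} = 15 / 16 * (1 / 16) ^ n := by
  rw [geom, geometricMeasure_real_singleton (by intro h; simpa using congrArg Subtype.val h)]
  norm_num [mul_comm]

theorem geom_singleton (n : ℕ) : geom {n} = ENNReal.ofReal (15 / 16 * (1 / 16) ^ n) := by
  rw [← geom_real_singleton, ofReal_measureReal]

theorem coin_singleton (s : Bool) : coin {s} = 2⁻¹ := by
  cases s <;> simp [coin]

theorem blockLaw_singleton (k : ℕ) (s : Bool) : blockLaw {(k, s)} = geom {k} * 2⁻¹ := by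
  rw [blockLaw, ← Set.singleton_prod_singleton, Measure.prod_prod, coin_singleton]

theorem stationary_singleton (j k : ℕ) (s : Bool) :
    stationary {(j, k, s)} = geom {j} * (geom {k} * 2⁻¹) := by
  rw [stationary, ← Set.singleton_prod_singleton, Measure.prod_prod, blockLaw_singleton]

theorem chain_singleton_succ (x : State) (j k : ℕ) (s : Bool) :
    chain x {(j + 1, k, s)} = Set.indicator {(j, k + 1, s)} 1 x := by
  obtain ⟨j', k', s'⟩ := x
  cases k' with
  | zero =>
    rw [chain_zero, Measure.map_apply (by fun_prop) (by simp)]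
    have : Prod.mk 0 ⁻¹' {(j + 1, k, s)} = (∅ : Set (ℕ × Bool)) := by ext; simp
    simp [this]
  | succ k' => simp [chain_succ, Set.indicator]

theorem chain_singleton_zero (x : State) (k : ℕ) (s : Bool) :
    chain x {(0, k, s)} = Set.indicator (Set.univ ×ˢ ({0} ×ˢ Set.univ))
      (fun _ => geom {k} * 2⁻¹) x := by
  obtain ⟨j', k', s'⟩ := x
  cases k' with
  | zero =>
    rw [chain_zero, Measure.map_apply (by fun_prop) (by simp)]
    have : Prod.mk 0 ⁻¹' {(0, k, s)} = ({(k, s)} : Set (ℕ × Bool)) := by ext; simp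
    simp [this, blockLaw_singleton]
  | succ k' => simp [chain_succ]

/-- A state of positive age has a single predecessor, with the same `j + k` and hence the same mass.
A state of age `0` is entered from every end of block, and these ends have total mass `geom {0}`. -/
theorem chain_invariant : chain.Invariant stationary := by
  refine Measure.ext_of_singleton fun x => ?_
  obtain ⟨j, k, s⟩ := x
  rw [Measure.bind_apply (by simp) chain.aemeasurable]
  cases j with
  | zero =>
    simp_rw [chain_singleton_zero]
    rw [lintegral_indicator_const (MeasurableSet.of_discrete), stationary_singleton]
    rw [stationary, Measure.prod_prod, blockLaw, Measure.prod_prod]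
    simp only [measure_univ, one_mul, mul_one]
    ring
  | succ j =>
    simp_rw [chain_singleton_succ]
    rw [lintegral_indicator_one (by simp), stationary_singleton, stationary_singleton,
      geom_singleton, geom_singleton, geom_singleton, geom_singleton, ← mul_assoc, ← mul_assoc,
      ← ENNReal.ofReal_mul (by positivity), ← ENNReal.ofReal_mul (by positivity)]
    congr 2
    ring

theorem stationary_singleton_pos (x : State) : 0 < stationary {x} := by
  obtain ⟨j, k, s⟩ := x
  rw [stationary_singleton, geom_singleton, geom_singleton]
  refine ENNReal.mul_pos ?_ (mul_ne_zero ?_ (by simp))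
  all_goals
    rw [Ne, ENNReal.ofReal_eq_zero, not_le]
    positivity

/-! ### Geometric ergodicity -/

instance chain_pow_isMarkovKernel (n : ℕ) : IsMarkovKernel (chain ^ n) := by
  induction n with
  | zero => rw [pow_zero]; exact inferInstanceAs (IsMarkovKernel Kernel.id)
  | succ n ih => rw [pow_succ]; exact inferInstanceAs (IsMarkovKernel ((chain ^ n) ∘ₖ chain))

theorem chain_pow_invariant (n : ℕ) : (chain ^ n).Invariant stationary := by
  induction n with
  | zero => rw [pow_zero]; exact Measure.id_comp
  | succ n ih => rw [pow_succ]; exact ih.comp chain_invariant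

theorem chain_pow_succ_apply (n : ℕ) (x : State) (A : Set State) :
    (chain ^ (n + 1)) x A = ∫⁻ y, (chain ^ n) y A ∂chain x := by
  rw [add_comm, Kernel.pow_add_apply_eq_lintegral _ _ _ _ MeasurableSet.of_discrete, pow_one]

/-- The probability that the chain is in `A` at the `n`-th step of a fresh block. -/
def fresh (A : Set State) (n : ℕ) : ℝ := ∫ y, ((chain ^ n) (0, y)).real A ∂blockLaw

theorem integrable_chain_pow (A : Set State) (n : ℕ) :
    Integrable (fun y : ℕ × Bool => ((chain ^ n) (0, y)).real A) blockLaw := by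
  refine Integrable.of_bound (C := 1) (Measurable.of_discrete).aestronglyMeasurable
    (.of_forall fun y => ?_)
  rw [Real.norm_of_nonneg measureReal_nonneg]
  exact measureReal_le_one

theorem chain_pow_block_end (A : Set State) (n j : ℕ) (s : Bool) :
    ((chain ^ (n + 1)) (j, 0, s)).real A = fresh A n := by
  rw [measureReal_def, chain_pow_succ_apply, chain_zero,
    lintegral_map Measurable.of_discrete (by fun_prop), fresh,
    integral_eq_lintegral_of_nonneg_ae (.of_forall fun _ => measureReal_nonneg)
      (Measurable.of_discrete).aestronglyMeasurable]
  simp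

/-- The renewal property: the remaining `k` steps are deterministic, and the step after them forgets
everything. -/
theorem chain_pow_add_block (A : Set State) (n j k : ℕ) (s : Bool) :
    ((chain ^ (n + k + 1)) (j, k, s)).real A = fresh A n := by
  induction k generalizing j with
  | zero => exact chain_pow_block_end A n j s
  | succ k ih =>
    rw [← ih (j + 1), measureReal_def, chain_pow_succ_apply, chain_succ,
      lintegral_dirac]
    rfl

theorem fresh_mem (A : Set State) (n : ℕ) : fresh A n ∈ Set.Icc (0 : ℝ) 1 := by
  rw [← chain_pow_block_end A n 0 true]
  exact ⟨measureReal_nonneg, measureReal_le_one⟩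

theorem hasSum_mul_eighth : HasSum (fun n : ℕ => (n : ℝ) * (1 / 8) ^ n) (8 / 49) := by
  have h := hasSum_coe_mul_geometric_of_norm_lt_one (r := (1 / 8 : ℝ)) (by norm_num)
  rwa [show (1 / 8 : ℝ) / (1 - 1 / 8) ^ 2 = 8 / 49 by norm_num] at h

/-- The weight `2 ^ k` turns the ratio `1 / 16` into `1 / 8`, giving the value `15 / 16 * (8 / 49)`.
That it is at most `1` is what closes the induction in `abs_fresh_succ_sub_le`. -/
theorem integrable_integral_mul_two_pow_le : Integrable (fun y : ℕ × Bool => (y.1 : ℝ) * 2 ^ y.1) blockLaw ∧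
    ∫ y : ℕ × Bool, (y.1 : ℝ) * 2 ^ y.1 ∂blockLaw ≤ 1 := by
  have hp : (⟨15 / 16, by norm_num, by norm_num⟩ : unitInterval) ≠ 0 := by
    intro h; simpa using congrArg Subtype.val h
  have e : (fun n : ℕ => (1 - (15 / 16) : ℝ) ^ n * (15 / 16) * ((n : ℝ) * 2 ^ n))
      = fun n : ℕ => 15 / 16 * ((n : ℝ) * (1 / 8) ^ n) := by
    ext n
    rw [show (1 / 8 : ℝ) = (1 - 15 / 16) * 2 by norm_num, mul_pow]
    ring
  have h1 : Integrable (fun n : ℕ => (n : ℝ) * 2 ^ n) geom := by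
    rw [geom, integrable_geometricMeasure_iff hp]
    have : ∀ n : ℕ, ‖(n : ℝ) * 2 ^ n‖ = n * 2 ^ n := fun n => Real.norm_of_nonneg (by positivity)
    simp_rw [this]
    rw [e]
    exact hasSum_mul_eighth.summable.mul_left _
  refine ⟨h1.comp_fst coin, ?_⟩
  have h2 := hasSum_integral_geometricMeasure hp h1
  simp only [smul_eq_mul] at h2
  rw [e] at h2
  have h3 := h2.unique (hasSum_mul_eighth.mul_left _)
  rw [blockLaw, integral_fun_fst (fun n : ℕ => (n : ℝ) * 2 ^ n)]
  simp only [probReal_univ, one_smul]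
  rw [geom, h3]
  norm_num

/-- Condition on the first block. If `k ≤ n`, the chain is fresh again with `n - k` steps left, and
comparing with `fresh A n` telescopes into `k` increments, each at most `(1 / 2) ^ (n - k + 1)` by
induction. Averaging `k * 2 ^ k` over the block law then loses nothing. -/
theorem abs_fresh_succ_sub_le (A : Set State) (n : ℕ) :
    |fresh A (n + 1) - fresh A n| ≤ (1 / 2) ^ (n + 1) := by
  induction n using Nat.strong_induction_on with
  | _ n ih =>
  have key : ∀ y : ℕ × Bool, |((chain ^ (n + 1)) (0, y)).real A - fresh A n|
      ≤ (1 / 2) ^ (n + 1) * ((y.1 : ℝ) * 2 ^ y.1) := by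
    rintro ⟨k, s⟩
    simp only
    rcases le_or_gt k n with hk | hk
    · obtain ⟨i, rfl⟩ := Nat.exists_eq_add_of_le' hk
      rw [chain_pow_add_block]
      have h : ∀ l ≤ k, |fresh A i - fresh A (i + l)| ≤ l * (1 / 2) ^ (i + 1) := by
        intro l hl
        induction l with
        | zero => simp
        | succ l ihl =>
          have h1 := ihl (by omega)
          have h2 := ih (i + l) (by omega)
          have h3 : ((1 : ℝ) / 2) ^ (i + l + 1) ≤ (1 / 2) ^ (i + 1) :=
            pow_le_pow_of_le_one (by norm_num) (by norm_num) (by omega)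
          have h4 := abs_sub_le (fresh A i) (fresh A (i + l)) (fresh A (i + (l + 1)))
          rw [abs_sub_comm (fresh A (i + l))] at h4
          rw [← add_assoc] at h4 ⊢
          push_cast
          linarith
      refine (h k le_rfl).trans (le_of_eq ?_)
      rw [show i + k + 1 = (i + 1) + k by ring, pow_add _ (i + 1) k]
      have : ((1 : ℝ) / 2) ^ k * 2 ^ k = 1 := by rw [← mul_pow]; norm_num
      linear_combination -((k : ℝ) * (1 / 2) ^ (i + 1)) * this
    -- A first block outlasting the `n + 1` steps: the trivial bound `1` suffices, as `2 ^ k`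
    -- already beats `(1 / 2) ^ (n + 1)`.
    · have h0 := fresh_mem A n
      have h1 : ((chain ^ (n + 1)) (0, k, s)).real A ∈ Set.Icc (0 : ℝ) 1 :=
        ⟨measureReal_nonneg, measureReal_le_one⟩
      have h2 : (1 : ℝ) ≤ (1 / 2) ^ (n + 1) * 2 ^ k := by
        calc (1 : ℝ) = (1 / 2) ^ (n + 1) * 2 ^ (n + 1) := by rw [← mul_pow]; norm_num
          _ ≤ _ := by gcongr <;> first | omega | norm_num
      have h3 : (1 : ℝ) ≤ k := by exact_mod_cast (by omega : 1 ≤ k)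
      calc _ ≤ (1 : ℝ) := by rw [abs_le]; constructor <;> linarith [h0.1, h0.2, h1.1, h1.2]
        _ ≤ k * ((1 / 2) ^ (n + 1) * 2 ^ k) := one_le_mul_of_one_le_of_one_le h3 h2
        _ = _ := by ring
  obtain ⟨hi, hle⟩ := integrable_integral_mul_two_pow_le
  have e : fresh A (n + 1) - fresh A n
      = ∫ y, (((chain ^ (n + 1)) (0, y)).real A - fresh A n) ∂blockLaw := by
    rw [integral_sub (integrable_chain_pow A _) (integrable_const _), integral_const]
    simp [fresh]
  rw [e]
  calc _ ≤ ∫ y, |((chain ^ (n + 1)) (0, y)).real A - fresh A n| ∂blockLaw :=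
        abs_integral_le_integral_abs
    _ ≤ ∫ y : ℕ × Bool, (1 / 2) ^ (n + 1) * ((y.1 : ℝ) * 2 ^ y.1) ∂blockLaw :=
        integral_mono_of_nonneg (.of_forall fun _ => abs_nonneg _) (hi.const_mul _)
          (.of_forall key)
    _ ≤ (1 / 2) ^ (n + 1) := by
        rw [integral_const_mul]
        exact mul_le_of_le_one_right (by positivity) hle

theorem abs_fresh_sub_stationary_le (A : Set State) (n : ℕ) :
    |fresh A n - stationary.real A| ≤ (1 / 2) ^ n := by
  have hd : ∀ n, dist (fresh A n) (fresh A (n + 1)) ≤ 1 / 2 * (1 / 2) ^ n := fun n => by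
    rw [dist_comm, Real.dist_eq, ← pow_succ']
    exact abs_fresh_succ_sub_le A n
  obtain ⟨l, hl⟩ := cauchySeq_tendsto_of_complete
    (cauchySeq_of_le_geometric _ _ (by norm_num) hd)
  have hx : ∀ x : State, Filter.Tendsto (fun n => ((chain ^ n) x).real A) Filter.atTop
      (nhds l) := by
    rintro ⟨j, k, s⟩
    rw [← Filter.tendsto_add_atTop_iff_nat (k + 1)]
    exact hl.congr fun n => (chain_pow_add_block A n j k s).symm
  -- The limit `l` is the same from every state, so averaging over the stationary law, which gives
  -- `stationary.real A` at every time, identifies it.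
  have hs : ∀ n, ∫ x, ((chain ^ n) x).real A ∂stationary = stationary.real A := fun n => by
    rw [integral_eq_lintegral_of_nonneg_ae (.of_forall fun _ => measureReal_nonneg)
      (Measurable.of_discrete).aestronglyMeasurable, measureReal_def]
    conv_rhs => rw [← (chain_pow_invariant n).def,
      Measure.bind_apply MeasurableSet.of_discrete (chain ^ n).aemeasurable]
    simp
  have ht := tendsto_integral_of_dominated_convergence (μ := stationary)
    (F := fun n x => ((chain ^ n) x).real A) (f := fun _ => l) (fun _ => 1)
    (fun n => (Measurable.of_discrete).aestronglyMeasurable) (integrable_const _)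
    (fun n => .of_forall fun x => by
      rw [Real.norm_of_nonneg measureReal_nonneg]; exact measureReal_le_one)
    (.of_forall hx)
  simp only [hs, integral_const, probReal_univ, one_smul] at ht
  rw [tendsto_nhds_unique tendsto_const_nhds ht, ← Real.dist_eq]
  refine (dist_le_of_le_geometric_of_tendsto _ _ (by norm_num) hd hl n).trans (le_of_eq ?_)
  norm_num

/-- After `k + 1` steps the bound for a fresh start applies; before that the right-hand side is at
least `1`. -/
theorem abs_chain_pow_sub_stationary_le (A : Set State) (n j k : ℕ) (s : Bool) :
    |((chain ^ n) (j, k, s)).real A - stationary.real A| ≤ 2 ^ (k + 1) * (1 / 2) ^ n := by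
  rcases le_or_gt (k + 1) n with h | h
  · obtain ⟨i, rfl⟩ := Nat.exists_eq_add_of_le' h
    rw [← add_assoc, chain_pow_add_block]
    refine (abs_fresh_sub_stationary_le A i).trans (le_of_eq ?_)
    rw [add_assoc, pow_add _ i]
    have : (2 : ℝ) ^ (k + 1) * (1 / 2) ^ (k + 1) = 1 := by rw [← mul_pow]; norm_num
    linear_combination (-(1 / 2 : ℝ) ^ i) * this
  · have h1 : ((chain ^ n) (j, k, s)).real A ∈ Set.Icc (0 : ℝ) 1 :=
      ⟨measureReal_nonneg, measureReal_le_one⟩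
    have h2 : stationary.real A ∈ Set.Icc (0 : ℝ) 1 := ⟨measureReal_nonneg, measureReal_le_one⟩
    calc _ ≤ (1 : ℝ) := by rw [abs_le]; constructor <;> linarith [h2.1, h2.2, h1.1, h1.2]
      _ = 2 ^ n * (1 / 2) ^ n := by rw [← mul_pow]; norm_num
      _ ≤ _ := by gcongr; norm_num

theorem chain_isGeometricallyErgodic : IsGeometricallyErgodic chain stationary := by
  refine ⟨inferInstance, chain_invariant, fun _ => 1 / 2, fun x => 2 ^ (x.2.1 + 1),
    fun _ => by norm_num, fun x => one_le_pow₀ (by norm_num), .of_forall fun x n => ?_⟩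
  exact iSup₂_le fun A _ => ENNReal.ofReal_le_ofReal (abs_chain_pow_sub_stationary_le A n _ _ _)

theorem chain_isPsiIrreducibleAperiodic : IsPsiIrreducibleAperiodic chain := by
  refine ⟨stationary, NeZero.ne _, ⟨inferInstance, fun A _ hA x => ?_⟩, fun ψ _ => ?_⟩
  · obtain ⟨j, k, s⟩ := x
    have hA' : 0 < stationary.real A := ENNReal.toReal_pos hA.ne' (measure_ne_top _ _)
    have ht : Filter.Tendsto (fun n : ℕ => (2 : ℝ) ^ (k + 1) * (1 / 2) ^ n) Filter.atTop
        (nhds 0) := by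
      simpa using (tendsto_pow_atTop_nhds_zero_of_lt_one (r := (1 / 2 : ℝ)) (by norm_num)
        (by norm_num)).const_mul ((2 : ℝ) ^ (k + 1))
    obtain ⟨N, hN⟩ := Filter.eventually_atTop.1 (ht.eventually_lt_const hA')
    refine ⟨N, fun n hn => ?_⟩
    have h1 := (abs_chain_pow_sub_stationary_le A n j k s).trans_lt (hN n hn)
    rw [abs_lt] at h1
    exact (ENNReal.toReal_pos_iff.1 (by rw [← measureReal_def]; linarith)).1
  -- Maximality is automatic, since `stationary` charges every point and has no nonempty null set.
  · refine Measure.AbsolutelyContinuous.mk fun A _ hA => ?_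
    have : A = ∅ := by
      by_contra h
      obtain ⟨x, hx⟩ := Set.nonempty_iff_ne_empty.2 h
      exact (stationary_singleton_pos x).ne'
        (measure_mono_null (Set.singleton_subset_iff.2 hx) hA)
    simp [this]

/-! ### The spectrum -/

theorem stationary_real_singleton (j k : ℕ) (s : Bool) :
    stationary.real {(j, k, s)} = 225 / 512 * (1 / 16) ^ (j + k) := by
  rw [measureReal_def, stationary_singleton, geom_singleton, geom_singleton, ENNReal.toReal_mul,
    ENNReal.toReal_mul, ENNReal.toReal_ofReal (by positivity),
    ENNReal.toReal_ofReal (by positivity)]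
  simp only [ENNReal.toReal_inv, ENNReal.toReal_ofNat]
  ring

/-- The states of the blocks of length `m + 1` and sign `s`. -/
def block (m : ℕ) (s : Bool) : Set State := {x | x.1 + x.2.1 = m ∧ x.2.2 = s}

theorem block_eq_image (m : ℕ) (s : Bool) :
    block m s = ((Finset.range (m + 1)).image fun j => ((j, m - j, s) : State) : Finset State) := by
  ext ⟨j, k, s'⟩
  simp only [block, Set.mem_ofPred_eq, Finset.coe_image, Set.mem_image, Finset.coe_range,
    Set.mem_Iio, Prod.mk.injEq]
  constructor
  · rintro ⟨h, rfl⟩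
    exact ⟨j, by omega, rfl, by omega, rfl⟩
  · rintro ⟨i, hi, rfl, rfl, rfl⟩
    exact ⟨by omega, rfl⟩

theorem stationary_real_block (m : ℕ) (s : Bool) :
    stationary.real (block m s) = (m + 1) * (225 / 512 * (1 / 16) ^ m) := by
  rw [block_eq_image, ← sum_measureReal_singleton, Finset.sum_image (by
    intro a _ b _ h; exact congrArg Prod.fst h)]
  rw [Finset.sum_congr rfl (g := fun _ => 225 / 512 * (1 / 16 : ℝ) ^ m)]
  · simp
  · intro j hj
    rw [stationary_real_singleton, Nat.add_sub_cancel' (by simpa [Nat.lt_succ_iff] using hj)]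

/-- A function supported on the positive blocks of length `m + 1`, which the chain multiplies by
`z` except at the ends of blocks. -/
def quasiEigen (z : ℂ) (m : ℕ) (x : State) : ℂ :=
  (block m true).indicator (fun x => z ^ x.1) x

theorem norm_quasiEigen {z : ℂ} (hz : ‖z‖ = 1) (m : ℕ) (x : State) :
    ‖quasiEigen z m x‖ = ‖(block m true).indicator (fun _ => (1 : ℝ)) x‖ := by
  by_cases h : x ∈ block m true <;> simp [quasiEigen, h, hz]

theorem memLp_quasiEigen {z : ℂ} (hz : ‖z‖ = 1) (m : ℕ) :
    MemLp (quasiEigen z m) 2 stationary := by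
  refine MemLp.of_bound (Measurable.of_discrete).aestronglyMeasurable 1 (.of_forall fun x => ?_)
  rw [norm_quasiEigen hz]
  by_cases h : x ∈ block m true <;> simp [h]

theorem eLpNorm_indicator_one (A : Set State) :
    (eLpNorm (A.indicator fun _ => (1 : ℝ)) 2 stationary).toReal = √(stationary.real A) := by
  rw [eLpNorm_indicator_const MeasurableSet.of_discrete (by norm_num) (by norm_num),
    ENNReal.toReal_mul, ← ENNReal.toReal_rpow, Real.sqrt_eq_rpow]
  simp [measureReal_def]

theorem norm_toLp_quasiEigen {z : ℂ} (hz : ‖z‖ = 1) (m : ℕ) :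
    ‖(memLp_quasiEigen hz m).toLp‖ = √(stationary.real (block m true)) := by
  rw [Lp.norm_toLp, ← eLpNorm_indicator_one,
    eLpNorm_congr_norm_ae (.of_forall (norm_quasiEigen hz m))]

theorem integral_quasiEigen_zero (z : ℂ) (m j : ℕ) (s : Bool) :
    ∫ y, quasiEigen z m y ∂chain (j, 0, s) = (15 / 32 * (1 / 16) ^ m : ℝ) := by
  rw [chain_zero, integral_map (by fun_prop) (Measurable.of_discrete).aestronglyMeasurable]
  have : (fun y : ℕ × Bool => quasiEigen z m (0, y))
      = Set.indicator {(m, true)} (fun _ => (1 : ℂ)) := by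
    ext ⟨k, s⟩
    by_cases h : k = m ∧ s = true <;> simp [quasiEigen, block, Set.indicator, h]
  rw [this, integral_indicator_const _ (by simp), measureReal_def, blockLaw_singleton,
    ENNReal.toReal_mul, ← measureReal_def, geom_real_singleton]
  simp
  ring

/-- Inside a block the two terms cancel exactly, as the age grows by one. At an end of block, the
first term survives only at the end of the chosen blocks, and the second is the probability of
drawing such a block next. -/
theorem norm_quasiEigen_sub_le {z : ℂ} (hz : ‖z‖ = 1) (m : ℕ) (x : State) :
    ‖z * quasiEigen z m x - ∫ y, quasiEigen z m y ∂chain x‖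
      ≤ ‖Set.indicator {(m, 0, true)} (fun _ => (1 : ℝ)) x + 15 / 32 * (1 / 16) ^ m‖ := by
  have hq : (0 : ℝ) ≤ 15 / 32 * (1 / 16) ^ m := by positivity
  obtain ⟨j, k, s⟩ := x
  cases k with
  | zero =>
    rw [integral_quasiEigen_zero]
    refine (norm_sub_le _ _).trans ?_
    rw [norm_mul, hz, one_mul, norm_quasiEigen hz, Complex.norm_real, Real.norm_of_nonneg hq]
    by_cases h : j = m ∧ s = true
    · simp only [block, Set.indicator, Set.mem_ofPred_eq, add_zero, h, and_self, if_true,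
        Set.mem_singleton_iff]
      rw [Real.norm_of_nonneg (by positivity), Real.norm_of_nonneg (by positivity)]
    · simp only [block, Set.indicator, Set.mem_ofPred_eq, add_zero, h, if_false,
        Set.mem_singleton_iff, Prod.mk.injEq, true_and]
      rw [Real.norm_of_nonneg (by positivity), Real.norm_of_nonneg (by positivity)]
  | succ k =>
    rw [chain_succ, integral_dirac]
    have : z * quasiEigen z m (j, k + 1, s) = quasiEigen z m (j + 1, k, s) := by
      have e : j + 1 + k = j + (k + 1) := by ring
      by_cases h : j + (k + 1) = m ∧ s = true <;>
        simp [quasiEigen, block, Set.indicator, e, h, pow_succ']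
    rw [this, sub_self, norm_zero]
    exact norm_nonneg _

theorem norm_sub_l2Operator_quasiEigen_le {z : ℂ} (hz : ‖z‖ = 1) (m : ℕ) :
    ‖(algebraMap ℂ (Lp ℂ 2 stationary →L[ℂ] Lp ℂ 2 stationary) z
        - l2Operator chain stationary chain_invariant) (memLp_quasiEigen hz m).toLp‖
      ≤ 2 * √(225 / 512 * (1 / 16) ^ m) := by
  set F := (memLp_quasiEigen hz m).toLp
  have hF : F =ᵐ[stationary] quasiEigen z m := MemLp.coeFn_toLp _
  have h1 : ((algebraMap ℂ (Lp ℂ 2 stationary →L[ℂ] Lp ℂ 2 stationary) z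
      - l2Operator chain stationary chain_invariant) F : State → ℂ) =ᵐ[stationary]
      fun x => z * quasiEigen z m x - ∫ y, quasiEigen z m y ∂chain x := by
    rw [sub_apply, Algebra.algebraMap_eq_smul_one, smul_apply,
      one_apply_eq_self]
    filter_upwards [Lp.coeFn_sub (z • F) (l2Operator chain stationary chain_invariant F),
      Lp.coeFn_smul z F, hF, l2Operator_ae_eq chain_invariant F,
      integral_kernel_congr_ae chain_invariant hF] with x a b c d e
    rw [a, Pi.sub_apply, b, Pi.smul_apply, c, d, e, smul_eq_mul]
  have hi : MemLp (Set.indicator {((m, 0, true) : State)} fun _ => (1 : ℝ)) 2 stationary :=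
    (memLp_const 1).indicator MeasurableSet.of_discrete
  have h2 : eLpNorm (fun _ : State => (15 / 32 * (1 / 16) ^ m : ℝ)) 2 stationary
      = ENNReal.ofReal (15 / 32 * (1 / 16) ^ m) := by
    rw [eLpNorm_const _ (by norm_num) (NeZero.ne _), measure_univ, ENNReal.one_rpow, mul_one,
      Real.enorm_of_nonneg (by positivity)]
  rw [Lp.norm_def, eLpNorm_congr_ae h1]
  have h3 : (eLpNorm (fun x => z * quasiEigen z m x - ∫ y, quasiEigen z m y ∂chain x) 2
      stationary).toReal ≤ √(225 / 512 * (1 / 16) ^ m) + 15 / 32 * (1 / 16) ^ m := by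
    have h4 : eLpNorm (fun x => z * quasiEigen z m x - ∫ y, quasiEigen z m y ∂chain x) 2
        stationary ≤ eLpNorm (Set.indicator {((m, 0, true) : State)} fun _ => (1 : ℝ)) 2 stationary
          + ENNReal.ofReal (15 / 32 * (1 / 16) ^ m) := by
      rw [← h2]
      exact (eLpNorm_mono (norm_quasiEigen_sub_le hz m)).trans
        (eLpNorm_add_le hi.1 aestronglyMeasurable_const (by norm_num))
    have h5 := ENNReal.toReal_mono (ENNReal.add_ne_top.2 ⟨hi.2.ne, ENNReal.ofReal_ne_top⟩) h4
    rw [ENNReal.toReal_add hi.2.ne (by simp), ENNReal.toReal_ofReal (by positivity)] at h5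
    rw [eLpNorm_indicator_one, stationary_real_singleton, add_zero] at h5
    exact h5
  refine h3.trans ?_
  have h6 : (1 / 16 : ℝ) ^ m ≤ 1 := pow_le_one₀ (by norm_num) (by norm_num)
  have h7 : (0 : ℝ) ≤ (1 / 16) ^ m := by positivity
  -- The square of the left side is `225 / 1024 * ((1 / 16) ^ m) ^ 2`, so the drawing probability is
  -- absorbed in the mass of one state.
  have h8 : 15 / 32 * (1 / 16 : ℝ) ^ m ≤ √(225 / 512 * (1 / 16) ^ m) := by
    apply Real.le_sqrt_of_sq_le
    nlinarith
  linarith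

theorem mem_spectrum_of_norm_eq_one {z : ℂ} (hz : ‖z‖ = 1) :
    z ∈ spectrum ℂ (l2Operator chain stationary chain_invariant) := by
  rw [spectrum.mem_iff]
  rintro ⟨u, hu⟩
  set R : Lp ℂ 2 stationary →L[ℂ] Lp ℂ 2 stationary := ↑u⁻¹ with hR
  -- A bounded inverse `R` would force `(m + 1) * δ ≤ 4 * ‖R‖ ^ 2 * δ`.
  obtain ⟨m, hm⟩ := exists_nat_gt (4 * ‖R‖ ^ 2)
  have h1 := norm_sub_l2Operator_quasiEigen_le hz m
  have h2 := norm_toLp_quasiEigen hz m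
  set F := (memLp_quasiEigen hz m).toLp
  rw [← hu] at h1
  set δ : ℝ := 225 / 512 * (1 / 16) ^ m with hδ
  have hδ0 : 0 < δ := by positivity
  have h3 : R ((u : Lp ℂ 2 stationary →L[ℂ] Lp ℂ 2 stationary) F) = F := by
    rw [← mul_apply_eq_comp, hR, Units.inv_mul, one_apply_eq_self]
  have h4 : ‖F‖ ≤ ‖R‖ * (2 * √δ) := by
    conv_lhs => rw [← h3]
    exact (R.le_opNorm _).trans (by gcongr)
  have h5 : ‖F‖ ^ 2 ≤ (‖R‖ * (2 * √δ)) ^ 2 := by gcongr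
  rw [h2, stationary_real_block, Real.sq_sqrt (by positivity), mul_pow, mul_pow,
    Real.sq_sqrt hδ0.le, ← hδ] at h5
  nlinarith

theorem not_hasSpectralGap :
    ¬ HasSpectralGap (l2Operator chain stationary chain_invariant) := by
  rintro ⟨ε, hε, hfin, -⟩
  have hinf : (Metric.sphere (0 : ℂ) 1).Infinite := by
    have hc : (Metric.sphere (0 : ℂ) 1).Nontrivial :=
      ⟨1, by simp, -1, by simp, by norm_num⟩
    exact (isPreconnected_sphere (by simp [Complex.rank_real_complex])
      0 1).infinite_of_nontrivial hc
  refine hinf (hfin.subset fun z hz => ?_)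
  have hz' : ‖z‖ = 1 := by simpa using hz
  refine ⟨⟨?_, mem_spectrum_of_norm_eq_one hz'⟩, ?_⟩
  · rintro rfl; simp at hz'
  · rw [Set.mem_ofPred_eq, hz']; linarith

end MarkovGap.Renewal

namespace MarkovGap

/-! ### The law of the stationary path -/

section PathLaw

variable {X : Type*} [MeasurableSpace X] {P : Kernel X X} [IsMarkovKernel P] {π : Measure X}

instance [IsProbabilityMeasure π] : IsProbabilityMeasure (pathLaw P π) := by
  unfold pathLaw; infer_instance

theorem pathLaw_map_zero : (pathLaw P π).map (fun w => w 0) = π := by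
  have h : (fun w : ℕ → X => w 0) = (fun v : (i : Finset.Iic 0) → X => v ⟨0, by simp⟩) ∘
      Preorder.frestrictLe (π := fun _ => X) 0 := rfl
  rw [h, ← Measure.map_map (by fun_prop) (by fun_prop), pathLaw, Kernel.trajMeasure,
    Measure.map_comp _ _ (by fun_prop), Kernel.traj_map_frestrictLe, Kernel.partialTraj_self,
    Measure.id_comp, Measure.map_map (by fun_prop) (by fun_prop)]
  exact Measure.map_id

variable [IsProbabilityMeasure π]

/-- The Markov property at time `n`, in the form from which all later facts on the path law are
derived. -/
theorem pathLaw_step (n : ℕ) {S : Set ((i : Finset.Iic n) → X)} (hS : MeasurableSet S)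
    {B : Set X} (hB : MeasurableSet B) :
    pathLaw P π {w | Preorder.frestrictLe (π := fun _ => X) n w ∈ S ∧ w (n + 1) ∈ B}
      = ∫⁻ w in Preorder.frestrictLe (π := fun _ => X) n ⁻¹' S, P (w n) B ∂pathLaw P π := by
  have h := Kernel.map_frestrictLe_trajMeasure_compProd_eq_map_trajMeasure
    (X := fun _ => X) (μ₀ := π) (κ := fun n => P.comap
      (fun w : (i : Finset.Iic n) → X => w ⟨n, Finset.mem_Iic.2 le_rfl⟩)
      (measurable_pi_apply _)) (a := n)
  change (pathLaw P π).map _ ⊗ₘ _ = (pathLaw P π).map _ at h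
  have h1 := DFunLike.congr_fun h (S ×ˢ B)
  rw [Measure.map_apply (by fun_prop) (hS.prod hB), Measure.compProd_apply_prod hS hB,
    setLIntegral_map hS (Kernel.measurable_coe _ hB) (by fun_prop)] at h1
  exact h1.symm

theorem pathLaw_map_apply (hπ : P.Invariant π) (n : ℕ) :
    (pathLaw P π).map (fun w => w n) = π := by
  induction n with
  | zero => exact pathLaw_map_zero
  | succ n ih =>
    ext B hB
    rw [Measure.map_apply (by fun_prop) hB]
    have h := pathLaw_step (P := P) (π := π) n MeasurableSet.univ hB
    simp only [Set.mem_univ, true_and, Set.preimage_univ, Measure.restrict_univ] at h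
    change pathLaw P π {w | w (n + 1) ∈ B} = _
    rw [h, ← lintegral_map (f := fun x => P x B) (P.measurable_coe hB) (measurable_pi_apply n), ih,
      ← Measure.bind_apply hB P.aemeasurable, hπ.def]

theorem pathLaw_pair_le {A B : Set X} (hA : MeasurableSet A) (hB : MeasurableSet B) {p : ℝ≥0∞}
    (hp : ∀ x, P x B ≤ p) {i j : ℕ} (hij : i < j) :
    pathLaw P π {w | w i ∈ A ∧ w j ∈ B} ≤ p * pathLaw P π {w | w i ∈ A} := by
  obtain ⟨j, rfl⟩ : ∃ k, j = k + 1 := ⟨j - 1, by omega⟩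
  have h := pathLaw_step (P := P) (π := π) j
    (S := (fun v : (i : Finset.Iic j) → X => v ⟨i, Finset.mem_Iic.2 (by omega)⟩) ⁻¹' A)
    (measurable_pi_apply _ hA) hB
  refine h.le.trans ?_
  calc _ ≤ ∫⁻ _ in {w : ℕ → X | w i ∈ A}, p ∂pathLaw P π := lintegral_mono fun w => hp _
    _ = _ := setLIntegral_const _ _

/-! ### Symmetries and almost sure transitions on a countable state space. -/

variable [Countable X] [DiscreteMeasurableSpace X]

theorem pathLaw_cylinder_succ (n : ℕ) (x : ℕ → X) :
    pathLaw P π {w | ∀ i ≤ n + 1, w i = x i}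
      = pathLaw P π {w | ∀ i ≤ n, w i = x i} * P (x n) {x (n + 1)} := by
  have h := pathLaw_step (P := P) (π := π) n
    (S := {Preorder.frestrictLe (π := fun _ => X) n x}) (measurableSet_singleton _)
    (measurableSet_singleton (x (n + 1)))
  have e : ∀ w : ℕ → X, Preorder.frestrictLe (π := fun _ => X) n w
      ∈ ({Preorder.frestrictLe (π := fun _ => X) n x} : Set _) ↔ ∀ i ≤ n, w i = x i := fun w => by
    rw [Set.mem_singleton_iff, funext_iff]
    simp
  have e' : Preorder.frestrictLe (π := fun _ => X) n ⁻¹'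
      {Preorder.frestrictLe (π := fun _ => X) n x} = {w | ∀ i ≤ n, w i = x i} := Set.ext e
  have hm : MeasurableSet {w : ℕ → X | ∀ i ≤ n, w i = x i} := by
    rw [← e']; exact (by fun_prop : Measurable _) (measurableSet_singleton _)
  rw [e', setLIntegral_congr_fun (g := fun _ => P (x n) {x (n + 1)}) hm
    (fun w hw => by simp only [hw n le_rfl]), setLIntegral_const, mul_comm] at h
  rw [← h]
  congr 1
  ext w
  simp only [Set.mem_ofPred_eq, e, Set.mem_singleton_iff]
  exact ⟨fun h => ⟨fun i hi => h i (by omega), h _ le_rfl⟩,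
    fun h i hi => (Nat.le_succ_iff.1 hi).elim (h.1 i) fun e => e ▸ h.2⟩

theorem pathLaw_cylinder_of_invariant {φ : X → X}
    (hπφ : ∀ x, π {φ x} = π {x}) (hPφ : ∀ x y, P (φ x) {φ y} = P x {y}) (n : ℕ) (x : ℕ → X) :
    pathLaw P π {w | ∀ i ≤ n, w i = φ (x i)} = pathLaw P π {w | ∀ i ≤ n, w i = x i} := by
  induction n with
  | zero =>
    have h : ∀ y : X, pathLaw P π {w | ∀ i ≤ 0, w i = y} = π {y} := fun y => by
      conv_rhs => rw [← pathLaw_map_zero (P := P) (π := π),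
        Measure.map_apply (by fun_prop) (measurableSet_singleton _)]
      congr 1
      ext w
      simp
    have h0 : ∀ x : ℕ → X, {w : ℕ → X | ∀ i ≤ 0, w i = x i} = {w | ∀ i ≤ 0, w i = x 0} :=
      fun x => by ext w; simp
    rw [h0 x, h0 fun i => φ (x i), h, h, hπφ]
  | succ n ih =>
    rw [pathLaw_cylinder_succ n fun i => φ (x i), pathLaw_cylinder_succ, ih, hPφ]

/-- An involution which preserves the transition kernel and the initial law preserves the law of
any functional of finitely many coordinates of the path. -/
theorem pathLaw_preimage_involutive {φ : X → X} (hφ : Function.Involutive φ)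
    (hπφ : ∀ x, π {φ x} = π {x}) (hPφ : ∀ x y, P (φ x) {φ y} = P x {y}) (n : ℕ)
    (S : Set (Fin (n + 1) → X)) :
    pathLaw P π {w | (fun i : Fin (n + 1) => φ (w i)) ∈ S}
      = pathLaw P π {w | (fun i : Fin (n + 1) => w i) ∈ S} := by
  have hφm : Measurable φ := Measurable.of_discrete
  have h : (pathLaw P π).map (fun w (i : Fin (n + 1)) => φ (w i))
      = (pathLaw P π).map (fun w (i : Fin (n + 1)) => w i) := by
    refine Measure.ext_of_singleton fun v => ?_
    have : Nonempty X := ⟨v 0⟩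
    rw [Measure.map_apply (by fun_prop) (measurableSet_singleton _),
      Measure.map_apply (by fun_prop) (measurableSet_singleton _)]
    have e := pathLaw_cylinder_of_invariant (P := P) (π := π) hπφ hPφ n
      -- The value `v 0` beyond the range is arbitrary: the cylinder only constrains times up to
      -- `n`.
      (fun i => if h : i < n + 1 then v ⟨i, h⟩ else v 0)
    convert e using 2
    · ext w
      simp only [Set.mem_preimage, Set.mem_singleton_iff, funext_iff, Set.mem_ofPred_eq]
      constructor
      · intro h i hi
        rw [dif_pos (by omega), ← h, hφ]
      · intro h i
        have := h i (by omega)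
        rw [dif_pos i.2] at this
        rw [this, hφ]
    · ext w
      simp only [Set.mem_preimage, Set.mem_singleton_iff, funext_iff, Set.mem_ofPred_eq]
      constructor
      · intro h i hi
        rw [dif_pos (by omega), ← h]
      · intro h i
        have := h i (by omega)
        rwa [dif_pos i.2] at this
  have h1 := DFunLike.congr_fun h S
  rwa [Measure.map_apply (by fun_prop) MeasurableSet.of_discrete,
    Measure.map_apply (by fun_prop) MeasurableSet.of_discrete] at h1

end PathLaw

theorem pathLaw_ae_step {X : Type*} [MeasurableSpace X] [Countable X] [DiscreteMeasurableSpace X]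
    {P : Kernel X X} [IsMarkovKernel P] {π : Measure X} [IsProbabilityMeasure π]
    {r : X → X → Prop} (h : ∀ x, ∀ᵐ y ∂P x, r x y) :
    ∀ᵐ w ∂pathLaw P π, ∀ n, r (w n) (w (n + 1)) := by
  refine ae_all_iff.2 fun n => ?_
  have h1 : ∀ x : X, ∀ᵐ w ∂pathLaw P π, w n = x → r (w n) (w (n + 1)) := fun x => by
    have h2 := pathLaw_step (P := P) (π := π) n
      (S := (fun v : (i : Finset.Iic n) → X => v ⟨n, Finset.mem_Iic.2 le_rfl⟩) ⁻¹' {x})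
      (measurable_pi_apply _ (measurableSet_singleton _)) (B := {y | ¬ r x y})
      MeasurableSet.of_discrete
    have hm : MeasurableSet {w : ℕ → X | w n = x} :=
      (measurable_pi_apply n : Measurable fun w : ℕ → X => w n) (measurableSet_singleton x)
    have h3 : ∫⁻ w in {w : ℕ → X | w n = x}, P (w n) {y | ¬ r x y} ∂pathLaw P π = 0 := by
      rw [setLIntegral_congr_fun (g := fun _ => 0) hm fun w hw => ?_, lintegral_zero]
      simp only [hw.out]
      exact h x
    rw [ae_iff]
    refine Eq.trans ?_ (h2.trans h3)
    congr 1
    ext w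
    simp only [Set.mem_ofPred_eq, Set.mem_preimage, Set.mem_singleton_iff,
      Preorder.frestrictLe_apply, Classical.not_imp]
    exact and_congr_right fun e => by rw [e]
  filter_upwards [ae_all_iff.2 h1] with w hw using hw _ rfl

namespace Renewal

/-! ### A function violating the central limit scaling -/

/-- The numerical sign `± 1`. -/
def sgn (s : Bool) : ℝ := if s then 1 else -1

theorem sgn_not (s : Bool) : sgn (!s) = -sgn s := by cases s <;> simp [sgn]

theorem abs_sgn (s : Bool) : |sgn s| = 1 := by cases s <;> simp [sgn]

/-- The lacunary sequence with value `(1 / 3) ^ i` at `4 ^ i`, and `0` elsewhere. -/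
def lacunary : ℕ → ℝ := Function.extend (fun i => 4 ^ i) (fun i => (1 / 3) ^ i) 0

/-- The absolute value of `observable` on the blocks of length `m + 1`. -/
def amplitude (m : ℕ) : ℝ := 4 ^ m * lacunary m

/-- The function which equals `± amplitude m` on the blocks of length `m + 1`. -/
def observable (x : State) : ℝ := sgn x.2.2 * amplitude (x.1 + x.2.1)

theorem pow_four_injective : Function.Injective fun i : ℕ => 4 ^ i :=
  Nat.pow_right_injective (by norm_num)

theorem lacunary_pow (i : ℕ) : lacunary (4 ^ i) = (1 / 3) ^ i :=
  pow_four_injective.extend_apply _ _ _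

/-- At `m = 4 ^ i` the term is `(4 / 9) ^ i + (1 / 9) ^ i`. The base `1 / 3` is below `1 / 2`, as
needed here, and above `1 / 4`, so that `m * lacunary m` is still unbounded. -/
theorem summable_lacunary : Summable fun m : ℕ => ((m : ℝ) + 1) * lacunary m ^ 2 := by
  rw [← pow_four_injective.summable_iff fun m hm => by
    rw [lacunary, Function.extend_apply' _ _ _ hm]; simp]
  have : ((fun m : ℕ => ((m : ℝ) + 1) * lacunary m ^ 2) ∘ fun i => 4 ^ i)
      = fun i => (4 / 9 : ℝ) ^ i + (1 / 9) ^ i := by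
    ext i
    simp only [Function.comp, lacunary_pow]
    push_cast
    rw [show (4 / 9 : ℝ) = 4 * (1 / 9) by norm_num, mul_pow,
      show (1 / 9 : ℝ) = (1 / 3) ^ 2 by norm_num,
      ← pow_mul, ← pow_mul, mul_comm 2 i]
    ring
  rw [this]
  exact (summable_geometric_of_lt_one (by norm_num) (by norm_num)).add
    (summable_geometric_of_lt_one (by norm_num) (by norm_num))

/-- The reversal of the signs of the blocks whose length is selected by `t`. -/
def flip (t : ℕ → Bool) (x : State) : State := (x.1, x.2.1, xor (t (x.1 + x.2.1)) x.2.2)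

theorem flip_involutive (t : ℕ → Bool) : Function.Involutive (flip t) := by
  rintro ⟨j, k, s⟩
  simp [flip]

theorem stationary_flip (t : ℕ → Bool) (x : State) : stationary {flip t x} = stationary {x} := by
  obtain ⟨j, k, s⟩ := x
  simp only [flip, stationary_singleton]

/-- The length `j + k + 1` is constant along a block, so the reversal is consistent inside it; a
fresh block has a fair sign independent of its length. -/
theorem chain_flip (t : ℕ → Bool) (x y : State) : chain (flip t x) {flip t y} = chain x {y} := by
  obtain ⟨j, k, s⟩ := y
  cases j with
  | zero =>
    simp only [flip]
    rw [chain_singleton_zero, chain_singleton_zero]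
    simp only [Set.indicator, Set.mem_prod, Set.mem_univ, Set.mem_singleton_iff, true_and, and_true]
  | succ j =>
    have e : flip t (j + 1, k, s) = (j + 1, k, (flip t (j, k + 1, s)).2.2) := by
      simp only [flip, Prod.mk.injEq, true_and]
      rw [show j + 1 + k = j + (k + 1) by ring]
    rw [e, chain_singleton_succ, chain_singleton_succ]
    have h : flip t x = (j, k + 1, (flip t (j, k + 1, s)).2.2) ↔ x = (j, k + 1, s) :=
      (flip_involutive t).injective.eq_iff (b := (j, k + 1, s))
    simp only [Set.indicator, Set.mem_singleton_iff, h, Pi.one_apply]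

theorem integral_observable : ∫ x, observable x ∂stationary = 0 := by
  have hm : stationary.map (flip fun _ => true) = stationary := by
    refine Measure.ext_of_singleton fun x => ?_
    rw [Measure.map_apply Measurable.of_discrete (by simp)]
    conv_rhs => rw [← stationary_flip (fun _ => true)]
    congr 1
    ext y
    rw [Set.mem_preimage, Set.mem_singleton_iff, Set.mem_singleton_iff,
      (flip_involutive _).eq_iff]
  have h : ∫ x, observable x ∂stationary = -∫ x, observable x ∂stationary := by
    conv_lhs => rw [← hm]
    rw [integral_map (Measurable.of_discrete).aemeasurable
      (Measurable.of_discrete).aestronglyMeasurable, ← integral_neg]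
    refine integral_congr_ae (.of_forall fun x => ?_)
    simp [observable, flip, sgn_not]
  linarith

theorem stationary_real_length (m : ℕ) :
    stationary.real {x | x.1 + x.2.1 = m} = (m + 1) * (225 / 256 * (1 / 16) ^ m) := by
  have h : {x : State | x.1 + x.2.1 = m} = block m true ∪ block m false := by
    ext ⟨j, k, s⟩
    cases s <;> simp [block]
  rw [h, measureReal_union (by
      rw [Set.disjoint_left]
      rintro x ⟨_, h1⟩ ⟨_, h2⟩
      simp [h1] at h2) MeasurableSet.of_discrete, stationary_real_block, stationary_real_block]
  ring

theorem memLp_observable : MemLp observable 2 stationary := by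
  rw [memLp_two_iff_integrable_sq (Measurable.of_discrete).aestronglyMeasurable]
  have h : (fun x => observable x ^ 2)
      = (fun m => amplitude m ^ 2) ∘ fun x : State => x.1 + x.2.1 := by
    ext ⟨j, k, s⟩
    cases s <;> simp [observable, sgn]
  rw [h, ← integrable_map_measure (Measurable.of_discrete).aestronglyMeasurable
    (Measurable.of_discrete).aemeasurable]
  refine ⟨(Measurable.of_discrete).aestronglyMeasurable, ?_⟩
  rw [hasFiniteIntegral_iff_ofReal (.of_forall fun _ => sq_nonneg _), lintegral_countable']
  have e : ∀ m : ℕ, ENNReal.ofReal (amplitude m ^ 2)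
      * (stationary.map fun x : State => x.1 + x.2.1) {m}
      = ENNReal.ofReal (225 / 256 * (((m : ℝ) + 1) * lacunary m ^ 2)) := fun m => by
    rw [Measure.map_apply Measurable.of_discrete (by simp)]
    change _ * stationary {x | x.1 + x.2.1 = m} = _
    rw [← ofReal_measureReal, stationary_real_length, ← ENNReal.ofReal_mul (sq_nonneg _)]
    congr 1
    -- The factor `4 ^ m` in the amplitude exactly balances the mass of the blocks.
    have : ((4 : ℝ) ^ m) ^ 2 * (1 / 16) ^ m = 1 := by
      rw [← pow_mul, mul_comm m 2, pow_mul, ← mul_pow]; norm_num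
    rw [amplitude]
    linear_combination (225 / 256 * (((m : ℝ) + 1) * lacunary m ^ 2)) * this
  simp_rw [e]
  exact (summable_lacunary.mul_left _).tsum_ofReal_lt_top

/-! ### Blocks along a path -/

/-- The path moves by deterministic steps inside blocks. -/
def IsBlockPath (w : ℕ → State) : Prop :=
  ∀ n j k s, w n = (j, k + 1, s) ↔ w (n + 1) = (j + 1, k, s)

theorem ae_isBlockPath : ∀ᵐ w ∂pathLaw chain stationary, IsBlockPath w := by
  refine pathLaw_ae_step (r := fun x y => ∀ j k s, x = (j, k + 1, s) ↔ y = (j + 1, k, s)) ?_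
  rintro ⟨j', k', s'⟩
  cases k' with
  | zero =>
    rw [chain_zero, ae_map_iff (Measurable.of_discrete).aemeasurable MeasurableSet.of_discrete]
    exact .of_forall fun y => by simp
  | succ k' =>
    rw [chain_succ, ae_dirac_iff MeasurableSet.of_discrete]
    simp

/-- A positive age determines the previous state, so a block can be traced back to its start or, if
it was already under way, to time `0`. -/
theorem IsBlockPath.backward {w : ℕ → State} (hw : IsBlockPath w) {t j k : ℕ} {s : Bool}
    (h : w t = (j, k, s)) :
    (j ≤ t → w (t - j) = (0, k + j, s)) ∧ (t < j → w 0 = (j - t, k + t, s)) := by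
  induction t generalizing j k with
  | zero =>
    refine ⟨fun hj => ?_, fun _ => by simpa using h⟩
    obtain rfl : j = 0 := by omega
    simpa using h
  | succ t ih =>
    cases j with
    | zero => exact ⟨fun _ => by simpa using h, fun hj => by omega⟩
    | succ j =>
      obtain ⟨h1, h2⟩ := ih ((hw _ _ _ _).2 h)
      refine ⟨fun hj => ?_, fun hj => ?_⟩
      · rw [Nat.add_sub_add_right, h1 (by omega), add_right_comm, add_assoc]
      · rw [Nat.add_sub_add_right, h2 (by omega), add_right_comm, add_assoc]

theorem IsBlockPath.forward {w : ℕ → State} (hw : IsBlockPath w) {i m : ℕ} {s : Bool}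
    (h : w i = (0, m, s)) {l : ℕ} (hl : l ≤ m) : w (i + l) = (l, m - l, s) := by
  induction l with
  | zero => simpa using h
  | succ l ih =>
    rw [← add_assoc, ← hw, ih (by omega), show m - l = m - (l + 1) + 1 by omega]

/-- The states at the start of a block of length `m + 1`. -/
def starts (m : ℕ) : Set State := {x | x.1 = 0 ∧ x.2.1 = m}

/-- Every visit to a block of this length before time `N` traces back to its start. That start is
`i` by `hu`, unless the block began before time `0`, which `h0` excludes; `hi` keeps the block from
being cut off at `N`. -/
theorem IsBlockPath.sum_block {w : ℕ → State} (hw : IsBlockPath w) {i m N : ℕ} (hi : i + m < N)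
    (hs : w i ∈ starts m) (hu : ∀ j < N, j ≠ i → w j ∉ starts m)
    (h0 : (w 0).1 + (w 0).2.1 = m → w 0 ∈ starts m) (a : ℝ) :
    ∑ t ∈ Finset.range N, (if (w t).1 + (w t).2.1 = m then sgn (w t).2.2 * a else 0)
      = (m + 1) * (sgn (w i).2.2 * a) := by
  obtain ⟨s, hs'⟩ : ∃ s, w i = (0, m, s) := ⟨(w i).2.2, by
    rw [← hs.1]; conv_rhs => rw [← hs.2]⟩
  have key : ∀ t ∈ Finset.range N, (if (w t).1 + (w t).2.1 = m then sgn (w t).2.2 * a else 0)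
      = if t ∈ Finset.Icc i (i + m) then sgn s * a else 0 := by
    intro t ht
    rw [Finset.mem_range] at ht
    by_cases hti : t ∈ Finset.Icc i (i + m)
    · rw [Finset.mem_Icc] at hti
      obtain ⟨l, rfl⟩ := Nat.exists_eq_add_of_le hti.1
      have hl : l ≤ m := by omega
      rw [hw.forward hs' hl, if_pos (by simp only; omega), if_pos (Finset.mem_Icc.2 hti)]
    · rw [if_neg hti, if_neg]
      intro hm
      obtain ⟨h1, h2⟩ := hw.backward (t := t) (j := (w t).1) (k := (w t).2.1) (s := (w t).2.2) rfl
      rcases le_or_gt (w t).1 t with hj | hj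
      · have h3 : w (t - (w t).1) ∈ starts m := by
          rw [h1 hj]; exact ⟨rfl, by simp only; omega⟩
        have h4 : t - (w t).1 = i := by
          by_contra h
          exact hu _ (by omega) h h3
        rw [Finset.mem_Icc] at hti
        omega
      · have h3 := h2 hj
        have h4 := (h0 (by rw [h3]; simp only; omega)).1
        rw [h3] at h4
        simp only at h4
        omega
  rw [Finset.sum_congr rfl key, Finset.sum_ite_mem, Finset.inter_eq_right.2 (by
    intro t ht
    rw [Finset.mem_Icc] at ht
    rw [Finset.mem_range]; omega), Finset.sum_const, Nat.card_Icc, hs', nsmul_eq_mul]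
  congr 1
  rw [show i + m + 1 - i = m + 1 by omega]
  push_cast
  rfl

/-! ### The probability of a long block -/

theorem chain_starts_le (m : ℕ) (x : State) :
    chain x (starts m) ≤ ENNReal.ofReal (15 / 16 * (1 / 16) ^ m) := by
  obtain ⟨j, k, s⟩ := x
  cases k with
  | zero =>
    rw [chain_zero, Measure.map_apply (by fun_prop) MeasurableSet.of_discrete]
    have : Prod.mk 0 ⁻¹' starts m = ({m} : Set ℕ) ×ˢ (Set.univ : Set Bool) := by
      ext; simp [starts]
    rw [this, blockLaw, Measure.prod_prod, geom_singleton, measure_univ, mul_one]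
  | succ k => simp [chain_succ, starts]

theorem stationary_real_starts (m : ℕ) :
    stationary.real (starts m) = 225 / 256 * (1 / 16) ^ m := by
  have h : starts m = {(0, m, true)} ∪ {(0, m, false)} := by
    ext ⟨j, k, s⟩
    cases s <;> simp [starts]
  rw [h, measureReal_union (by simp) (by simp), stationary_real_singleton,
    stationary_real_singleton, zero_add]
  ring

/-- The paths for which the block starting at time `i` is the only one of length `m + 1` starting
before time `N`. -/
def soleStart (m N i : ℕ) : Set (ℕ → State) :=
  {w | w i ∈ starts m ∧ ∀ j < N, j ≠ i → w j ∉ starts m}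

theorem measurableSet_eval (i : ℕ) (A : Set State) : MeasurableSet {w : ℕ → State | w i ∈ A} :=
  measurable_pi_apply i MeasurableSet.of_discrete

theorem measurableSet_soleStart (m N i : ℕ) : MeasurableSet (soleStart m N i) := by
  have : soleStart m N i = {w | w i ∈ starts m} ∩
      ⋂ (j) (_ : j < N) (_ : j ≠ i), {w | w j ∈ (starts m)ᶜ} := by
    ext w; simp [soleStart]
  rw [this]
  exact (measurableSet_eval _ _).inter <| .iInter fun j => .iInter fun _ => .iInter fun _ =>
    measurableSet_eval _ _

theorem pathLaw_real_eval (i : ℕ) (A : Set State) :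
    (pathLaw chain stationary).real {w | w i ∈ A} = stationary.real A := by
  conv_rhs => rw [← pathLaw_map_apply chain_invariant i]
  rw [map_measureReal_apply (by fun_prop) MeasurableSet.of_discrete]
  rfl

theorem pathLaw_real_starts_pair_le (m : ℕ) {i j : ℕ} (hij : i ≠ j) :
    (pathLaw chain stationary).real {w | w i ∈ starts m ∧ w j ∈ starts m}
      ≤ 15 / 16 * (1 / 16) ^ m * (225 / 256 * (1 / 16) ^ m) := by
  wlog h : i < j generalizing i j
  · have h' := this hij.symm (by omega)
    rwa [show {w : ℕ → State | w j ∈ starts m ∧ w i ∈ starts m}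
      = {w | w i ∈ starts m ∧ w j ∈ starts m} from Set.ext fun w => and_comm] at h'
  have h1 := pathLaw_pair_le (P := chain) (π := stationary) (A := starts m) (B := starts m)
    MeasurableSet.of_discrete MeasurableSet.of_discrete (chain_starts_le m) h
  have h2 := ENNReal.toReal_mono
    (ENNReal.mul_ne_top ENNReal.ofReal_ne_top (measure_ne_top _ _)) h1
  rwa [ENNReal.toReal_mul, ENNReal.toReal_ofReal (by positivity), ← measureReal_def,
    ← measureReal_def, pathLaw_real_eval, stationary_real_starts] at h2

/-- Union bound over a second start: given one start, each other time adds conditional probability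
at most `15 / 16 * (1 / 16) ^ m`, and `hN` keeps the total below `1 / 4`. -/
theorem pathLaw_real_soleStart_ge (m N i : ℕ) (hN : 4 * (N : ℝ) ≤ 16 ^ m) :
    3 / 4 * (225 / 256 * (1 / 16) ^ m) ≤ (pathLaw chain stationary).real (soleStart m N i) := by
  set Q := pathLaw chain stationary
  have hsub : {w : ℕ → State | w i ∈ starts m} ⊆ soleStart m N i ∪
      ⋃ j ∈ (Finset.range N).erase i, {w | w i ∈ starts m ∧ w j ∈ starts m} := by
    intro w hw
    by_cases h : w ∈ soleStart m N i
    · exact Or.inl h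
    · right
      simp only [soleStart, Set.mem_ofPred_eq, not_and, not_forall, not_not] at h
      obtain ⟨j, hj, hji, hjs⟩ := h hw
      simp only [Set.mem_iUnion]
      exact ⟨j, by simp [hj, hji], hw, hjs⟩
  have h1 : Q.real {w | w i ∈ starts m} ≤ Q.real (soleStart m N i)
      + ∑ j ∈ (Finset.range N).erase i, Q.real {w | w i ∈ starts m ∧ w j ∈ starts m} :=
    (measureReal_mono hsub).trans <| (measureReal_union_le _ _).trans <|
      add_le_add_right (measureReal_biUnion_finset_le _ _) _
  have h2 : ∑ j ∈ (Finset.range N).erase i, Q.real {w | w i ∈ starts m ∧ w j ∈ starts m}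
      ≤ N * (15 / 16 * (1 / 16) ^ m * (225 / 256 * (1 / 16) ^ m)) := by
    refine (Finset.sum_le_card_nsmul _ _ _ fun j hj =>
      pathLaw_real_starts_pair_le m (Finset.ne_of_mem_erase hj).symm).trans ?_
    rw [nsmul_eq_mul]
    gcongr
    exact (Finset.card_le_card (Finset.erase_subset _ _)).trans (by simp)
  rw [pathLaw_real_eval, stationary_real_starts] at h1
  have h3 : (16 : ℝ) ^ m * (1 / 16) ^ m = 1 := by rw [← mul_pow]; norm_num
  have hq : (0 : ℝ) < (1 / 16) ^ m := by positivity
  have h4 : 4 * (N * (1 / 16 : ℝ) ^ m) ≤ 1 := by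
    have := mul_le_mul_of_nonneg_right hN hq.le
    rwa [h3, mul_assoc] at this
  have h5 : (N : ℝ) * (15 / 16 * (1 / 16) ^ m * (225 / 256 * (1 / 16) ^ m))
      ≤ 1 / 4 * (225 / 256 * (1 / 16) ^ m) := by
    have : (N : ℝ) * (15 / 16 * (1 / 16) ^ m) ≤ 1 / 4 := by nlinarith
    calc _ = (N : ℝ) * (15 / 16 * (1 / 16) ^ m) * (225 / 256 * (1 / 16) ^ m) := by ring
      _ ≤ _ := by gcongr
  linarith

/-- The paths with a block of length `m + 1` which lies within the first `N` times, and which no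
other block of this length meets. -/
def soleBlock (m N : ℕ) : Set (ℕ → State) :=
  (⋃ i ∈ Finset.range (N - m), soleStart m N i) \ {w | w 0 ∈ {x : State | x.1 + x.2.1 = m}}

/-- The events for different `i` are disjoint, so their probabilities add up: at least `N / 2`
starts leave room for the whole block, which gives `675 / 8192`. Excluding a block of this length at
time `0` costs at most `1 / 128`. -/
theorem pathLaw_real_soleBlock_ge {m N : ℕ} (hm : 4 ≤ m) (hN : 4 * N = 16 ^ m) :
    1 / 16 ≤ (pathLaw chain stationary).real (soleBlock m N) := by
  set Q := pathLaw chain stationary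
  have hN' : 4 * (N : ℝ) = 16 ^ m := by exact_mod_cast hN
  have h3 : (16 : ℝ) ^ m * (1 / 16) ^ m = 1 := by rw [← mul_pow]; norm_num
  have h1 : Q.real (⋃ i ∈ Finset.range (N - m), soleStart m N i)
      = ∑ i ∈ Finset.range (N - m), Q.real (soleStart m N i) := by
    refine measureReal_biUnion_finset (fun i hi j hj hij => ?_)
      fun i _ => measurableSet_soleStart m N i
    refine Set.disjoint_left.2 fun w h1 h2 => ?_
    have : j < N - m := by simpa using hj
    exact h1.2 j (by omega) hij.symm h2.1
  have h2 : ((N - m : ℕ) : ℝ) * (3 / 4 * (225 / 256 * (1 / 16) ^ m))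
      ≤ ∑ i ∈ Finset.range (N - m), Q.real (soleStart m N i) := by
    have := Finset.card_nsmul_le_sum (Finset.range (N - m)) (fun i => Q.real (soleStart m N i)) _
      fun i _ => pathLaw_real_soleStart_ge m N i hN'.le
    rwa [Finset.card_range, nsmul_eq_mul] at this
  have h4 : Q.real (⋃ i ∈ Finset.range (N - m), soleStart m N i)
      - Q.real {w | w 0 ∈ {x : State | x.1 + x.2.1 = m}} ≤ Q.real (soleBlock m N) := by
    have := measureReal_mono (μ := Q) (Set.subset_sdiff_union
      (⋃ i ∈ Finset.range (N - m), soleStart m N i) {w | w 0 ∈ {x : State | x.1 + x.2.1 = m}})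
    have h' := measureReal_union_le (μ := Q) (soleBlock m N)
      {w | w 0 ∈ {x : State | x.1 + x.2.1 = m}}
    rw [soleBlock] at h' ⊢
    linarith
  rw [pathLaw_real_eval, stationary_real_length, h1] at h4
  have hmN : 2 * m + 2 ≤ N := by
    have a1 : m < 2 ^ m := Nat.lt_two_pow_self
    have a2 : 2 ^ 4 ≤ 2 ^ m := Nat.pow_le_pow_right (by norm_num) hm
    have a3 : 16 ^ m = 2 ^ m * 2 ^ m * (2 ^ m * 2 ^ m) := by
      rw [← mul_pow, ← mul_pow]; norm_num
    have a4 : 16 * 2 ^ m ≤ 2 ^ m * 2 ^ m := Nat.mul_le_mul_right _ a2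
    have a5 : 2 ^ m * 2 ^ m * 1 ≤ 2 ^ m * 2 ^ m * (2 ^ m * 2 ^ m) :=
      Nat.mul_le_mul_left _ (Nat.one_le_iff_ne_zero.2 (by positivity))
    linarith
  have h5 : (N : ℝ) / 2 ≤ ((N - m : ℕ) : ℝ) := by
    rw [Nat.cast_sub (by omega)]
    have : (2 * m + 2 : ℝ) ≤ N := by exact_mod_cast hmN
    linarith
  have h6 : ((m : ℝ) + 1) * (225 / 256 * (1 / 16) ^ m) ≤ 1 / 128 := by
    have a1 : (m : ℝ) + 1 ≤ 2 ^ m := by exact_mod_cast (Nat.lt_two_pow_self : m < 2 ^ m)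
    have a2 : (2 : ℝ) ^ m * (1 / 16) ^ m = (1 / 8) ^ m := by rw [← mul_pow]; norm_num
    have a3 : (1 / 8 : ℝ) ^ m ≤ (1 / 8) ^ 4 := pow_le_pow_of_le_one (by norm_num) (by norm_num) hm
    calc _ ≤ (2 : ℝ) ^ m * (225 / 256 * (1 / 16) ^ m) := by gcongr
      _ = 225 / 256 * (1 / 8) ^ m := by rw [← a2]; ring
      _ ≤ 225 / 256 * (1 / 8) ^ 4 := by gcongr
      _ ≤ _ := by norm_num
  have h7 : (N : ℝ) / 2 * (3 / 4 * (225 / 256 * (1 / 16) ^ m)) = 675 / 8192 := by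
    rw [← hN'] at h3
    linear_combination (675 / 8192) * h3
  have h8 : (N : ℝ) / 2 * (3 / 4 * (225 / 256 * (1 / 16) ^ m))
      ≤ ((N - m : ℕ) : ℝ) * (3 / 4 * (225 / 256 * (1 / 16) ^ m)) := by gcongr
  rw [h7] at h8
  linarith

/-! ### Symmetrization and failure of tightness. -/

theorem observable_sub_flip (m : ℕ) (x : State) :
    observable x - observable (flip (fun l => decide (l = m)) x)
      = 2 * if x.1 + x.2.1 = m then sgn x.2.2 * amplitude m else 0 := by
  by_cases h : x.1 + x.2.1 = m
  · simp only [observable, flip, h, decide_true, Bool.true_xor, sgn_not, if_true]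
    ring
  · simp [observable, flip, h]

/-- On `soleBlock`, the sum and its reflected version differ by twice the contribution of the sole
block, so one of them is at least that large in absolute value. Both have the same law, hence half
of `1 / 16`. -/
theorem pathLaw_real_abs_sum_ge {m N : ℕ} (hm : 4 ≤ m) (hN : 4 * N = 16 ^ m)
    (ha : 0 ≤ amplitude m) :
    1 / 32 ≤ (pathLaw chain stationary).real
      {w | (m + 1) * amplitude m ≤ |∑ i ∈ Finset.range N, observable (w i)|} := by
  set Q := pathLaw chain stationary
  obtain ⟨n, rfl⟩ : ∃ n, N = n + 1 := ⟨N - 1, by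
    have : 0 < 16 ^ m := by positivity
    omega⟩
  set φ := flip fun l => decide (l = m)
  have hφ : Q.real {w | (m + 1) * amplitude m
        ≤ |∑ i ∈ Finset.range (n + 1), observable (φ (w i))|}
      = Q.real {w | (m + 1) * amplitude m ≤ |∑ i ∈ Finset.range (n + 1), observable (w i)|} := by
    have h := pathLaw_preimage_involutive (P := chain) (π := stationary)
      (flip_involutive fun l => decide (l = m)) (stationary_flip _) (chain_flip _) n
      {v | (m + 1) * amplitude m ≤ |∑ i, observable (v i)|}
    rw [measureReal_def, measureReal_def]
    simp_rw [Finset.sum_range]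
    exact congrArg ENNReal.toReal h
  have hsub : soleBlock m (n + 1) ≤ᵐ[Q]
      ({w | (m + 1) * amplitude m ≤ |∑ i ∈ Finset.range (n + 1), observable (w i)|} ∪
      {w | (m + 1) * amplitude m
        ≤ |∑ i ∈ Finset.range (n + 1), observable (φ (w i))|} : Set _) := by
    filter_upwards [ae_isBlockPath] with w hw hwB
    obtain ⟨hw1, hw2⟩ := hwB
    simp only [Set.mem_iUnion, Finset.mem_range] at hw1
    obtain ⟨i, hi, hs, hu⟩ := hw1
    have h1 := hw.sum_block (by omega) hs hu (fun h => absurd h hw2) (amplitude m)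
    have h2 : ∑ t ∈ Finset.range (n + 1), observable (w t)
        - ∑ t ∈ Finset.range (n + 1), observable (φ (w t))
        = 2 * ((m + 1) * (sgn (w i).2.2 * amplitude m)) := by
      rw [← Finset.sum_sub_distrib, ← h1, Finset.mul_sum]
      exact Finset.sum_congr rfl fun t _ => observable_sub_flip m (w t)
    have h3 := abs_sub (∑ t ∈ Finset.range (n + 1), observable (w t))
      (∑ t ∈ Finset.range (n + 1), observable (φ (w t)))
    have h4 : |2 * ((m + 1) * (sgn (w i).2.2 * amplitude m))| = 2 * ((m + 1) * amplitude m) := by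
      rw [abs_mul, abs_mul, abs_mul, abs_sgn, abs_of_nonneg ha, one_mul,
        abs_of_nonneg (by positivity : (0 : ℝ) ≤ (m : ℝ) + 1), abs_of_nonneg (by norm_num)]
    rw [h2, h4] at h3
    by_contra h
    have h' : ¬ _ ∧ ¬ _ := not_or.1 h
    simp only [Set.mem_ofPred_eq, not_le] at h'
    linarith [h'.1, h'.2]
  have h1 := ENNReal.toReal_mono (measure_ne_top Q _) (measure_mono_ae hsub)
  have h2 := (pathLaw_real_soleBlock_ge hm hN).trans (h1.trans (measureReal_union_le _ _))
  rw [hφ] at h2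
  linarith

theorem not_isTightMeasureSet_normalizedSum :
    ¬ IsTightMeasureSet {μ : Measure ℝ | ∃ n : ℕ, 1 ≤ n ∧
      μ = (pathLaw chain stationary).map (normalizedSum observable n)} := by
  intro h
  have ht := tendsto_measure_norm_gt_of_isTightMeasureSet h
  obtain ⟨r, hr⟩ := (ht.eventually_lt_const
    (show (0 : ℝ≥0∞) < ENNReal.ofReal (1 / 32) by simp)).exists
  obtain ⟨i, hi⟩ := pow_unbounded_of_one_lt r (show (1 : ℝ) < 4 / 3 by norm_num)
  have hi' : r < (4 / 3 : ℝ) ^ (i + 1) :=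
    hi.trans_le (pow_le_pow_right₀ (by norm_num) (by omega))
  obtain ⟨m, hmdef⟩ : ∃ m, m = 4 ^ (i + 1) := ⟨_, rfl⟩
  have hm : 4 ≤ m := by 
    rw [hmdef, pow_succ]
    have : 0 < 4 ^ i := by positivity
    omega
  -- This time scale makes `√N = 4 ^ m / 2`, cancelling the factor `4 ^ m` of the amplitude; what is
  -- left exceeds `(4 / 3) ^ (i + 1)`.
  obtain ⟨N, hN⟩ : ∃ N, 4 * N = 16 ^ m :=
    ⟨4 * 16 ^ (m - 1), by
    rw [← mul_assoc, show 4 * 4 = 16 from rfl, ← pow_succ', show m - 1 + 1 = m by omega]⟩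
  have hN1 : 1 ≤ N := by
    have : 0 < 16 ^ m := by positivity
    omega
  have hN' : 4 * (N : ℝ) = 16 ^ m := by exact_mod_cast hN
  have hsq : √(N : ℝ) = 4 ^ m / 2 := by
    rw [Real.sqrt_eq_iff_eq_sq (by positivity) (by positivity), div_pow, ← pow_mul, mul_comm m 2,
      pow_mul]
    norm_num
    linarith
  have hl : lacunary m = (1 / 3) ^ (i + 1) := by rw [hmdef, lacunary_pow]
  have ha : 0 ≤ amplitude m := by rw [amplitude, hl]; positivity
  have hbig : r < (m + 1) * amplitude m / √N := by
    have e : (m + 1) * amplitude m / √N = 2 * ((m + 1) * (1 / 3) ^ (i + 1)) := by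
      rw [hsq, amplitude, hl]
      field_simp
    have e2 : (m : ℝ) * (1 / 3) ^ (i + 1) = (4 / 3) ^ (i + 1) := by
      rw [hmdef]; push_cast; rw [← mul_pow]; norm_num
    have e3 : (0 : ℝ) < (1 / 3) ^ (i + 1) := by positivity
    have e4 : (0 : ℝ) < (4 / 3) ^ (i + 1) := by positivity
    rw [e, add_mul, e2]
    linarith
  have hmeas : Measurable (normalizedSum observable N) := by
    unfold normalizedSum
    have : Measurable observable := Measurable.of_discrete
    fun_prop
  have h1 : ENNReal.ofReal (1 / 32)
      ≤ (pathLaw chain stationary).map (normalizedSum observable N) {x | r < ‖x‖} := by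
    rw [Measure.map_apply hmeas (measurableSet_lt measurable_const measurable_norm)]
    calc _ ≤ pathLaw chain stationary
          {w | (m + 1) * amplitude m ≤ |∑ i ∈ Finset.range N, observable (w i)|} := by
          rw [← ofReal_measureReal]
          exact ENNReal.ofReal_le_ofReal (pathLaw_real_abs_sum_ge hm hN ha)
      _ ≤ _ := measure_mono fun w hw => by
          have hw' : (m + 1) * amplitude m ≤ |∑ i ∈ Finset.range N, observable (w i)| := hw
          change r < ‖normalizedSum observable N w‖
          rw [normalizedSum, norm_div, Real.norm_eq_abs, Real.norm_of_nonneg (Real.sqrt_nonneg _)]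
          exact hbig.trans_le (by gcongr)
  have h2 : (pathLaw chain stationary).map (normalizedSum observable N) {x | r < ‖x‖} ≤
      ⨆ μ ∈ {μ : Measure ℝ | ∃ n : ℕ, 1 ≤ n ∧
        μ = (pathLaw chain stationary).map (normalizedSum observable n)}, μ {x | r < ‖x‖} :=
    le_iSup₂ (f := fun (μ : Measure ℝ) _ => μ {x | r < ‖x‖}) _ ⟨N, hN1, rfl⟩
  exact (h1.trans h2).not_gt hr

end Renewal

end MarkovGap

end

theorem theorem2 :
    ∃ (X : Type) (_ : Countable X) (_ : MeasurableSpace X) (_ : DiscreteMeasurableSpace X)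
      (P : Kernel X X) (_ : IsMarkovKernel P)
      (π : Measure X) (_ : IsProbabilityMeasure π) (hπ : P.Invariant π),
      MarkovGap.IsPsiIrreducibleAperiodic P ∧
      MarkovGap.IsGeometricallyErgodic P π ∧
      ¬ MarkovGap.HasSpectralGap (MarkovGap.l2Operator P π hπ) ∧
      ∃ G : X → ℝ, MemLp G 2 π ∧ ∫ x, G x ∂π = 0 ∧
        ¬ IsTightMeasureSet {μ : Measure ℝ | ∃ n : ℕ, 1 ≤ n ∧
          μ = (MarkovGap.pathLaw P π).map (MarkovGap.normalizedSum G n)} :=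
  ⟨MarkovGap.Renewal.State, inferInstance, inferInstance, inferInstance,
    MarkovGap.Renewal.chain, inferInstance, MarkovGap.Renewal.stationary, inferInstance,
    MarkovGap.Renewal.chain_invariant, MarkovGap.Renewal.chain_isPsiIrreducibleAperiodic,
    MarkovGap.Renewal.chain_isGeometricallyErgodic, MarkovGap.Renewal.not_hasSpectralGap,
    MarkovGap.Renewal.observable, MarkovGap.Renewal.memLp_observable,
    MarkovGap.Renewal.integral_observable,
    MarkovGap.Renewal.not_isTightMeasureSet_normalizedSum⟩
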